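/- Let $\mathbb D=\{z\in\mathbb C:|z|<1\}$. Let $f:\mathbb D\to\mathbb C$ be a holomorphic infinitesimal generator, i.e. for every $z\in\mathbb D$ the Cauchy problem $\frac{\partial u(t,z)}{\partial t}+f(u(t,z))=0$, $u(0,z)=z$, has a unique solution $u(t,z)\in\mathbb D$ for all $t\ge 0$. Suppose that $f(0)=0$ and that $q:=f'(0)$ satisfies $\Re q>0$. For $r>0$ let $G_r:=(\mathrm{Id}+rf)^{-1}:\mathbb D\to\mathbb D$ be the nonlinear resolvent of $f$, so that $w=G_r(z)$ is the point of $\mathbb D$ with $w+rf(w)=z$. Then: 1. for every $r>\frac{2}{\Re q}$ one has $|G_r(z)|\le\dfrac{3}{1+r\,\Re q}$ for all $z\in\mathbb D$; 2. for every $r>\frac{2}{\Re q}$ the map $G_r$ has no boundary fixed points, that is, there is no $\zeta$ with $|\zeta|=1$ at which the angular (non-tangential) limit of $G_r$ exists and equals $\zeta$; 3. $G_r\to 0$ uniformly on $\mathbb D$ as $r\to\infty$. -/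

import Mathlib

open Filter Topology

/-- `u` solves the Cauchy problem `u' + f(u) = 0`, `u(0) = z` on `[0, ∞)`, with values in the
open unit disk. -/
def IsDiskFlowLine (f : ℂ → ℂ) (z : ℂ) (u : ℝ → ℂ) : Prop :=
  u 0 = z ∧ ∀ t : ℝ, 0 ≤ t →
    u t ∈ Metric.ball (0 : ℂ) 1 ∧ HasDerivWithinAt u (-f (u t)) (Set.Ici 0) t

/-- An infinitesimal generator on the open unit disk: a holomorphic function on the disk for which
the Cauchy problem `u' + f(u) = 0`, `u(0) = z` has, for every `z` in the disk, a unique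
solution in the disk for all times `t ≥ 0`. -/
def IsDiskGenerator (f : ℂ → ℂ) : Prop :=
  DifferentiableOn ℂ f (Metric.ball (0 : ℂ) 1) ∧
    ∀ z ∈ Metric.ball (0 : ℂ) 1, ∃ u : ℝ → ℂ, IsDiskFlowLine f z u ∧
      ∀ v : ℝ → ℂ, IsDiskFlowLine f z v → Set.EqOn v u (Set.Ici 0)

/-- The nonlinear resolvent `G_r = (Id + r f)⁻¹`, the inverse being that of the map `Id + r f` on
the open unit disk: `nonlinearResolvent f r z` is the point `w` of the disk
with `w + r f(w) = z`. -/
noncomputable def nonlinearResolvent (f : ℂ → ℂ) (r : ℝ) : ℂ → ℂ :=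
  Function.invFunOn (fun w : ℂ => w + (r : ℂ) * f w) (Metric.ball (0 : ℂ) 1)

/-- The Stolz region in the open unit disk with vertex `ζ` and aperture `M`. -/
def stolzRegion (ζ : ℂ) (M : ℝ) : Set ℂ :=
  {z : ℂ | ‖z‖ < 1 ∧ ‖ζ - z‖ < M * (1 - ‖z‖)}

/-- `ζ` on the unit circle is a boundary fixed point of `G` if the angular (non-tangential) limit
of `G` at `ζ` exists and equals `ζ`. -/
def IsBoundaryFixedPoint (G : ℂ → ℂ) (ζ : ℂ) : Prop :=
  ‖ζ‖ = 1 ∧ ∀ M : ℝ, 1 < M → Tendsto G (𝓝[stolzRegion ζ M] ζ) (𝓝 ζ)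

/-!
The time-`t` maps of the flow are holomorphic, since the linearized equation along a flow line
produces the derivative in the initial point. They map the disk into itself and fix `0`, so by the
Schwarz lemma every flow line satisfies `‖u t‖ ≤ ‖z‖`, and differentiating at `t = 0` shows that
`p z = f z / z` has nonnegative real part. Consequently `‖w + r f(w)‖ = ‖w‖ ‖1 + r p(w)‖ ≥ ‖w‖`,
and with the open mapping theorem `Id + r f` covers the disk, so the resolvent is defined.

If `w + r f(w) = z` with `‖z‖ < 1`, then `‖w‖ (1 + r Re p(w)) < 1`. Harnack's inequality bounds
`Re p(w)` below by `Re q (1 - ‖w‖) / (1 + ‖w‖)`, and with `a = r Re q` the result factors as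
`0 < (1 - (a - 1) ‖w‖) (1 - ‖w‖)`. Hence `‖w‖ < 1 / (a - 1)`, which is at most `3 / (1 + a)` as
soon as `a ≥ 2`. For `a > 2` the latter is less than `1`, which excludes boundary fixed points.
-/

open Metric Set

section Flow

variable {𝕜 E F : Type*} [RCLike 𝕜] [NormedAddCommGroup E] [NormedSpace 𝕜 E]
  [NormedAddCommGroup F] [NormedSpace 𝕜 F]

theorem eventually_forall_mem_norm_sub_fderiv_le {f : E → F} {K : Set E} (hK : IsCompact K)
    (hf : ∀ a ∈ K, ContDiffAt 𝕜 1 f a) {ε : ℝ} (hε : 0 < ε) :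
    ∀ᶠ h in 𝓝 0, ∀ a ∈ K, ‖f (a + h) - f a - fderiv 𝕜 f a h‖ ≤ ε * ‖h‖ := by
  refine hK.eventually_forall_of_forall_eventually fun b hb => ?_
  have hstrict := ((hf b hb).hasStrictFDerivAt one_ne_zero).isLittleO.def (half_pos hε)
  have hshift : Tendsto (fun p : E × E => (p.2 + p.1, p.2)) (𝓝 (0, b)) (𝓝 (b, b)) :=
    Continuous.tendsto' (by fun_prop) _ _ (by simp)
  have hfderiv : ∀ᶠ a in 𝓝 b, ‖fderiv 𝕜 f b - fderiv 𝕜 f a‖ < ε / 2 := by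
    simpa only [dist_eq_norm_sub'] using
      ((hf b hb).continuousAt_fderiv one_ne_zero).eventually (ball_mem_nhds _ (half_pos hε))
  filter_upwards [hshift.eventually hstrict, continuousAt_snd.eventually hfderiv] with ⟨h, a⟩ h₁ h₂
  simp only [add_sub_cancel_left] at h₁
  calc ‖f (a + h) - f a - fderiv 𝕜 f a h‖
      = ‖f (a + h) - f a - fderiv 𝕜 f b h + (fderiv 𝕜 f b - fderiv 𝕜 f a) h‖ := by
        rw [sub_apply]; congr 1; abel
    _ ≤ ε / 2 * ‖h‖ + ε / 2 * ‖h‖ :=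
        norm_add_le_of_le h₁ (ContinuousLinearMap.le_of_opNorm_le _ h₂.le h)
    _ = ε * ‖h‖ := by ring

variable [NormedSpace ℝ E]

theorem hasDerivWithinAt_Ici_of_isIntegralCurveOn_Icc {γ : ℝ → E} {v : ℝ → E → E} {a b t : ℝ}
    (hγ : IsIntegralCurveOn γ v (Icc a b)) (ht : t ∈ Ico a b) :
    HasDerivWithinAt γ (v t (γ t)) (Ici t) t :=
  (hγ t (Ico_subset_Icc_self ht)).mono_of_mem_nhdsWithin (Icc_mem_nhdsGE_of_mem ht)

theorem norm_sub_sub_le_of_linearization {f : E → E} {A : ℝ → E →L[𝕜] E} {u v y : ℝ → E}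
    {T L C ε : ℝ} (hu : IsIntegralCurveOn u (fun _ => f) (Icc 0 T))
    (hv : IsIntegralCurveOn v (fun _ => f) (Icc 0 T))
    (hy : IsIntegralCurveOn y (fun t => A t) (Icc 0 T)) (h0 : v 0 - u 0 = y 0)
    (hA : ∀ t ∈ Icc 0 T, ‖A t‖ ≤ L) (hyC : ∀ t ∈ Icc 0 T, ‖y t‖ ≤ C) (hC : 0 < C)
    (hε : 0 < ε) (hε1 : ε < 1)
    (hf : ∀ h : E, ‖h‖ ≤ C + ε * C * Real.exp ((L + 2) * T) → ∀ t ∈ Icc 0 T,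
      ‖f (u t + h) - f (u t) - A t h‖ ≤ ε * ‖h‖) :
    ∀ t ∈ Icc 0 T, ‖v t - u t - y t‖ ≤ ε * C * Real.exp ((L + 2) * t) := by
  -- The error has to grow slower than the barrier only where it equals the barrier, and there `v t`
  -- is still close enough to `u t` for the Taylor estimate `hf`.
  refine image_norm_le_of_norm_deriv_right_lt_deriv_boundary
    (f := fun t => v t - u t - y t) (f' := fun t => f (v t) - f (u t) - A t (y t))
    (B' := fun t => ε * C * (Real.exp ((L + 2) * t) * (L + 2)))
    ((hv.continuousOn.sub hu.continuousOn).sub hy.continuousOn)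
    (fun t ht => ((hasDerivWithinAt_Ici_of_isIntegralCurveOn_Icc hv ht).sub
      (hasDerivWithinAt_Ici_of_isIntegralCurveOn_Icc hu ht)).sub
      (hasDerivWithinAt_Ici_of_isIntegralCurveOn_Icc hy ht))
    (by rw [h0, sub_self, norm_zero]; positivity)
    (fun t => by simpa using (((hasDerivAt_id t).const_mul (L + 2)).exp).const_mul (ε * C))
    fun t ht hη => ?_
  have ht' := Ico_subset_Icc_self ht
  have hL : 0 ≤ L := (norm_nonneg _).trans (hA t ht')
  set B := ε * C * Real.exp ((L + 2) * t) with hB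
  have hB0 : 0 < B := by positivity
  have hCB : ε * C ≤ B :=
    le_mul_of_one_le_right (by positivity) (Real.one_le_exp (mul_nonneg (by linarith) ht.1))
  have hh : ‖v t - u t‖ ≤ C + B := by
    calc ‖v t - u t‖ = ‖y t + (v t - u t - y t)‖ := by rw [add_sub_cancel]
      _ ≤ C + B := norm_add_le_of_le (hyC t ht') hη.le
  have hrem : ‖f (v t) - f (u t) - A t (v t - u t)‖ ≤ ε * (C + B) := by
    have hsmall : ‖v t - u t‖ ≤ C + ε * C * Real.exp ((L + 2) * T) := by
      refine hh.trans ?_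
      rw [hB]
      gcongr
      exact ht.2.le
    have := hf _ hsmall t ht'
    rw [add_sub_cancel] at this
    exact this.trans (by gcongr)
  calc ‖f (v t) - f (u t) - A t (y t)‖
      = ‖f (v t) - f (u t) - A t (v t - u t) + A t (v t - u t - y t)‖ := by
        rw [map_sub (A t) _ (y t)]; congr 1; abel
    _ ≤ ε * (C + B) + L * B :=
        norm_add_le_of_le hrem (((A t).le_of_opNorm_le (hA t ht') _).trans_eq (by rw [hη]))
    _ < (L + 2) * B := by nlinarith
    _ = ε * C * (Real.exp ((L + 2) * t) * (L + 2)) := by rw [hB]; ring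

theorem hasFDerivAt_of_variational_equation {f : E → E} {Φ : E → ℝ → E} {Y : ℝ → E →L[𝕜] E}
    {z : E} {T : ℝ} (hT : 0 ≤ T)
    (hΦ : ∀ᶠ w in 𝓝 z, Φ w 0 = w ∧ IsIntegralCurveOn (Φ w) (fun _ => f) (Icc 0 T))
    (hf : ∀ t ∈ Icc 0 T, ContDiffAt 𝕜 1 f (Φ z t)) (hY0 : Y 0 = .id 𝕜 E)
    (hYcont : ContinuousOn Y (Icc 0 T))
    (hY : ∀ h, IsIntegralCurveOn (fun t => Y t h) (fun t => fderiv 𝕜 f (Φ z t)) (Icc 0 T)) :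
    HasFDerivAt (fun w => Φ w T) (Y T) z := by
  obtain ⟨hz0, hz⟩ := hΦ.self_of_nhds
  have hAcont : ContinuousOn (fun t => fderiv 𝕜 f (Φ z t)) (Icc 0 T) := fun t ht =>
    ((hf t ht).continuousAt_fderiv one_ne_zero).comp_continuousWithinAt (hz.continuousOn t ht)
  obtain ⟨L, hL⟩ := isCompact_Icc.exists_bound_of_continuousOn hAcont
  obtain ⟨c, hc0, hc⟩ : ∃ c > 0, ∀ t ∈ Icc 0 T, ‖Y t‖ ≤ c :=
    let ⟨c, hc⟩ := isCompact_Icc.exists_bound_of_continuousOn hYcont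
    ⟨max c 1, by positivity, fun t ht => (hc t ht).trans (le_max_left _ _)⟩
  refine hasFDerivAt_iff_isLittleO.2 (Asymptotics.isLittleO_iff.2 fun η hη => ?_)
  set e := Real.exp ((L + 2) * T)
  obtain ⟨ε, hε, hεη⟩ : ∃ ε > 0, ε < min 1 (η / (c * e)) := exists_between (by positivity)
  obtain ⟨hε1, hεη⟩ := lt_min_iff.1 hεη
  have htaylor := eventually_forall_mem_norm_sub_fderiv_le
    (isCompact_Icc.image_of_continuousOn hz.continuousOn) (forall_mem_image.2 hf) hε
  obtain ⟨δ, hδ, htaylor⟩ := eventually_nhds_iff_ball.1 htaylor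
  have hnear : ∀ᶠ w in 𝓝 z, c * ‖w - z‖ + ε * (c * ‖w - z‖) * e < δ := by
    refine Tendsto.eventually_lt_const hδ (Continuous.tendsto' (by fun_prop) _ _ ?_)
    simp
  filter_upwards [hΦ, hnear] with w ⟨hw0, hw⟩ hwδ
  rcases eq_or_ne w z with rfl | hwz
  · simp
  have hwz0 : 0 < ‖w - z‖ := norm_pos_iff.2 (sub_ne_zero.2 hwz)
  calc ‖Φ w T - Φ z T - Y T (w - z)‖
      ≤ ε * (c * ‖w - z‖) * e :=
        norm_sub_sub_le_of_linearization hz hw (hY (w - z)) (by simp [hz0, hw0, hY0]) hL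
          (fun t ht => (Y t).le_of_opNorm_le (hc t ht) _) (by positivity) hε hε1
          (fun h hh t ht => htaylor h (mem_ball_zero_iff.2 (hh.trans_lt hwδ)) _
            (mem_image_of_mem _ ht)) T (right_mem_Icc.2 hT)
    _ = ε * (c * e) * ‖w - z‖ := by ring
    _ ≤ η * ‖w - z‖ := by
        gcongr
        exact ((lt_div_iff₀ (by positivity)).1 hεη).le

theorem differentiableAt_of_isIntegralCurveOn {f : ℂ → ℂ} {Φ : ℂ → ℝ → ℂ} {z : ℂ} {T : ℝ}
    (hT : 0 ≤ T) (hΦ : ∀ᶠ w in 𝓝 z, Φ w 0 = w ∧ IsIntegralCurveOn (Φ w) (fun _ => f) (Icc 0 T))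
    (hf : ∀ t ∈ Icc 0 T, AnalyticAt ℂ f (Φ z t)) :
    DifferentiableAt ℂ (fun w => Φ w T) z := by
  have hcont : ContinuousOn (fun t => deriv f (Φ z t)) (Icc 0 T) := fun t ht =>
    (hf t ht).deriv.continuousAt.comp_continuousWithinAt (hΦ.self_of_nhds.2.continuousOn t ht)
  set a : ℝ → ℂ := IccExtend hT ((Icc 0 T).domRestrict fun t => deriv f (Φ z t))
  have ha : Continuous a := hcont.domRestrict.Icc_extend'
  -- In dimension one the variational equation `Y' = f'(Φ z) Y` is solved by an exponential.
  set Y : ℝ → ℂ := fun t => Complex.exp (∫ s in 0..t, a s) with hYdef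
  have hY (t : ℝ) : HasDerivAt Y (Y t * a t) t :=
    (ha.integral_hasStrictDerivAt 0 t).hasDerivAt.cexp
  refine (hasFDerivAt_of_variational_equation (𝕜 := ℂ) (Y := fun t => Y t • .id ℂ ℂ) hT
    hΦ (fun t ht => (hf t ht).contDiffAt) ?_ ?_ ?_).differentiableAt
  · ext
    simp [hYdef]
  · have : Continuous Y := continuous_iff_continuousAt.2 fun t => (hY t).continuousAt
    fun_prop
  · intro h t ht
    have hat : a t = deriv f (Φ z t) := IccExtend_of_mem hT _ ht
    refine ((hY t).mul_const h).hasDerivWithinAt.congr_deriv ?_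
    simp [hat, mul_left_comm, mul_comm]

end Flow

theorem inner_nonpos_of_hasDerivWithinAt_of_norm_le {E : Type*} [NormedAddCommGroup E]
    [InnerProductSpace ℝ E] {u : ℝ → E} {u' : E} {a : ℝ}
    (hu : HasDerivWithinAt u u' (Ici a) a) (hle : ∀ t ∈ Ici a, ‖u t‖ ≤ ‖u a‖) :
    inner ℝ (u a) u' ≤ 0 := by
  have hmax : IsMaxOn (fun t => ‖u t‖ ^ 2) (Ici a) a := fun t ht =>
    pow_le_pow_left₀ (norm_nonneg _) (hle t ht) 2
  have hone : (1 : ℝ) ∈ posTangentConeAt (Ici a) a :=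
    mem_posTangentConeAt_of_segment_subset (by
      rw [segment_eq_Icc (by linarith)]; exact Icc_subset_Ici_self)
  have := hmax.localize.hasFDerivWithinAt_nonpos hu.norm_sq.hasFDerivWithinAt hone
  simp only [ContinuousLinearMap.toSpanSingleton_apply, one_smul] at this
  linarith

section Harnack

theorem norm_add_conj_sq_sub_norm_sub_sq (a b : ℂ) :
    ‖a + starRingEnd ℂ b‖ ^ 2 - ‖a - b‖ ^ 2 = 4 * (a.re * b.re) := by
  simp only [Complex.sq_norm, Complex.normSq_apply, Complex.add_re, Complex.add_im, Complex.sub_re,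
    Complex.sub_im, Complex.conj_re, Complex.conj_im]
  ring

theorem norm_sub_le_norm_add_conj {a b : ℂ} (ha : 0 ≤ a.re) (hb : 0 ≤ b.re) :
    ‖a - b‖ ≤ ‖a + starRingEnd ℂ b‖ := by
  refine le_of_sq_le_sq ?_ (norm_nonneg _)
  linarith [norm_add_conj_sq_sub_norm_sub_sq a b, mul_nonneg ha hb]

theorem re_mul_one_sub_le_of_norm_sub_le {a b : ℂ} {s : ℝ} (hs0 : 0 ≤ s) (hs1 : s ≤ 1)
    (hab : 0 ≤ a.re + b.re) (h : ‖a - b‖ ≤ s * ‖a + starRingEnd ℂ b‖) :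
    b.re * (1 - s) ≤ a.re * (1 + s) := by
  have hsq : ‖a - b‖ ^ 2 ≤ s ^ 2 * ‖a + starRingEnd ℂ b‖ ^ 2 := by
    rw [← mul_pow]; gcongr
  simp only [Complex.sq_norm, Complex.normSq_apply, Complex.add_re, Complex.add_im, Complex.sub_re,
    Complex.sub_im, Complex.conj_re, Complex.conj_im] at hsq
  have him : 0 ≤ (1 - s ^ 2) * (a.im - b.im) ^ 2 :=
    mul_nonneg (sub_nonneg.2 (pow_le_one₀ hs0 hs1)) (sq_nonneg _)
  have hre : (b.re - a.re) ^ 2 ≤ (s * (a.re + b.re)) ^ 2 := by linarith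
  linarith [le_of_sq_le_sq hre (mul_nonneg hs0 hab)]

theorem re_harnack_of_re_nonneg {E : Type*} [NormedAddCommGroup E] [NormedSpace ℂ E] {p : E → ℂ}
    {c z : E} {R : ℝ} (hp : DifferentiableOn ℂ p (ball c R))
    (hre : ∀ w ∈ ball c R, 0 ≤ (p w).re) (hz : z ∈ ball c R) :
    (p c).re * (R - dist z c) ≤ (p z).re * (R + dist z c) := by
  have hR : 0 < R := pos_of_mem_ball hz
  have hc : 0 ≤ (p c).re := hre c (mem_ball_self hR)
  rcases hc.eq_or_lt with hc | hc
  · rw [← hc, zero_mul]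
    exact mul_nonneg (hre z hz) (by positivity)
  have hden (w) (hw : w ∈ ball c R) : p w + starRingEnd ℂ (p c) ≠ 0 := fun h => by
    have := congrArg Complex.re h
    simp only [Complex.add_re, Complex.conj_re, Complex.zero_re] at this
    linarith [hre w hw]
  -- The Cayley transform centred at `p c` turns this into the Schwarz lemma.
  have hschwarz := Complex.dist_le_div_mul_dist_of_mapsTo_ball
    (f := fun w => (p w - p c) / (p w + starRingEnd ℂ (p c))) (R₂ := 1)
    (by simpa only [div_eq_mul_inv] using (hp.sub_const _).fun_mul ((hp.add_const _).fun_inv hden))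
    (fun w hw => by
      simpa using div_le_one_of_le₀ (norm_sub_le_norm_add_conj (hre w hw) hc.le) (norm_nonneg _))
    hz
  simp only [sub_self, zero_div, dist_zero_right, norm_div] at hschwarz
  rw [div_le_iff₀ (norm_pos_iff.2 (hden z hz))] at hschwarz
  have hs1 : 1 / R * dist z c ≤ 1 := by
    rw [one_div_mul_eq_div]; exact div_le_one_of_le₀ (mem_ball.1 hz).le hR.le
  have := re_mul_one_sub_le_of_norm_sub_le (by positivity) hs1
    (add_nonneg (hre z hz) hc.le) hschwarz
  field_simp at this
  exact this

theorem norm_lt_inv_of_norm_mul_one_add_mul_lt_one {p : ℂ → ℂ}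
    (hp : DifferentiableOn ℂ p (ball 0 1)) (hre : ∀ z ∈ ball (0 : ℂ) 1, 0 ≤ (p z).re) {r : ℝ}
    (hr : 1 < r * (p 0).re) {w : ℂ} (hw : w ∈ ball (0 : ℂ) 1) (h : ‖w * (1 + r * p w)‖ < 1) :
    ‖w‖ < (r * (p 0).re - 1)⁻¹ := by
  have hr0 : 0 < r := pos_of_mul_pos_left (one_pos.trans hr) (hre 0 (mem_ball_self one_pos))
  have hw1 : ‖w‖ < 1 := by simpa using hw
  have hre_lt : ‖w‖ * (1 + r * (p w).re) < 1 := by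
    refine lt_of_le_of_lt ?_ (norm_mul w _ ▸ h)
    gcongr
    simpa using Complex.re_le_norm (1 + r * p w)
  have hharnack : r * (p 0).re * (1 - ‖w‖) ≤ r * (p w).re * (1 + ‖w‖) := by
    have := re_harnack_of_re_nonneg hp hre hw
    rw [dist_zero_right] at this
    simpa only [mul_assoc] using mul_le_mul_of_nonneg_left this hr0.le
  set a := r * (p 0).re
  have hquad : ‖w‖ * (1 + ‖w‖ + a * (1 - ‖w‖)) < 1 + ‖w‖ := by
    calc ‖w‖ * (1 + ‖w‖ + a * (1 - ‖w‖))
        ≤ ‖w‖ * (1 + ‖w‖ + r * (p w).re * (1 + ‖w‖)) := by gcongr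
      _ = ‖w‖ * (1 + r * (p w).re) * (1 + ‖w‖) := by ring
      _ < 1 * (1 + ‖w‖) := by gcongr
      _ = 1 + ‖w‖ := one_mul _
  have hfactor : 0 < (1 - ‖w‖ * (a - 1)) * (1 - ‖w‖) := by linarith
  rw [← one_div, lt_div_iff₀ (sub_pos.2 hr)]
  linarith [pos_of_mul_pos_left hfactor (sub_nonneg.2 hw1.le)]

end Harnack

section Image

theorem ball_subset_image_ball_of_isOpen_image {X E : Type*} [PseudoMetricSpace X] [ProperSpace X]
    [NormedAddCommGroup E] [NormedSpace ℝ E] {h : X → E} {c : X} {r s : ℝ} (hr : 0 < r)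
    (hopen : IsOpen (h '' ball c r)) (hcont : ContinuousOn h (closedBall c r))
    (hsphere : ∀ w ∈ sphere c r, s ≤ dist (h w) (h c)) : ball (h c) s ⊆ h '' ball c r := by
  rcases le_or_gt s 0 with hs | hs
  · simp [ball_eq_empty.2 hs]
  have hclosed : IsClosed (h '' closedBall c r) :=
    ((isCompact_closedBall c r).image_of_continuousOn hcont).isClosed
  refine (convex_ball (h c) s).isPreconnected.subset_of_closure_inter_subset hopen
    ⟨h c, mem_ball_self hs, mem_image_of_mem h (mem_ball_self hr)⟩ ?_
  rintro y ⟨hy, hys⟩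
  obtain ⟨w, hw, rfl⟩ := closure_minimal (image_mono ball_subset_closedBall) hclosed hy
  exact mem_image_of_mem h <| mem_ball.2 <|
    lt_of_le_of_ne hw fun hwr => (hsphere w hwr).not_gt hys

theorem ball_subset_image_ball_of_dist_le {h : ℂ → ℂ} {c : ℂ} {R : ℝ}
    (hd : DifferentiableOn ℂ h (ball c R))
    (hle : ∀ w ∈ ball c R, dist w c ≤ dist (h w) (h c)) : ball (h c) R ⊆ h '' ball c R := by
  intro z hz
  obtain ⟨ρ, hzρ, hρR⟩ := exists_between (mem_ball.1 hz)
  have hρ : 0 < ρ := dist_nonneg.trans_lt hzρ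
  have hsub : closedBall c ρ ⊆ ball c R := closedBall_subset_ball hρR
  have hopen : IsOpen (h '' ball c ρ) := by
    rcases (hd.analyticOnNhd isOpen_ball).is_constant_or_isOpen (convex_ball c R).isPreconnected
      with ⟨k, hk⟩ | ho
    · have hmem : c + ρ ∈ ball c R := by simpa [abs_of_pos hρ] using hρR
      have := hle _ hmem
      rw [hk _ hmem, hk c (mem_ball_self (hρ.trans hρR)), dist_self] at this
      simp [hρ.ne'] at this
    · exact ho _ (ball_subset_closedBall.trans hsub) isOpen_ball
  exact image_mono (ball_subset_ball hρR.le) <|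
    ball_subset_image_ball_of_isOpen_image hρ hopen (hd.continuousOn.mono hsub)
      (fun w hw => hw.ge.trans (hle w (hsub (sphere_subset_closedBall hw)))) hzρ

end Image

section Generator

variable {f : ℂ → ℂ}

theorem IsDiskFlowLine.isIntegralCurveOn {z : ℂ} {u : ℝ → ℂ} (hu : IsDiskFlowLine f z u) (T : ℝ) :
    IsIntegralCurveOn u (fun _ w => -f w) (Icc 0 T) :=
  fun t ht => (hu.2 t ht.1).2.mono Icc_subset_Ici_self

theorem differentiableOn_of_isDiskFlowLine (hf : DifferentiableOn ℂ f (ball 0 1))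
    {Φ : ℂ → ℝ → ℂ} (hΦ : ∀ z ∈ ball (0 : ℂ) 1, IsDiskFlowLine f z (Φ z)) {t : ℝ} (ht : 0 ≤ t) :
    DifferentiableOn ℂ (fun w => Φ w t) (ball 0 1) := fun z hz =>
  (differentiableAt_of_isIntegralCurveOn ht
    ((isOpen_ball.eventually_mem hz).mono fun w hw => ⟨(hΦ w hw).1, (hΦ w hw).isIntegralCurveOn t⟩)
    fun s hs => (hf.analyticAt (isOpen_ball.mem_nhds ((hΦ z hz).2 s hs.1).1)).neg)
    |>.differentiableWithinAt

theorem self_mul_dslope_zero (hf0 : f 0 = 0) (z : ℂ) : z * dslope f 0 z = f z := by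
  simpa [hf0] using sub_smul_dslope f 0 z

namespace IsDiskGenerator

theorem norm_flowLine_le (hf : IsDiskGenerator f) (hf0 : f 0 = 0) {z : ℂ}
    (hz : z ∈ ball (0 : ℂ) 1) {u : ℝ → ℂ} (hu : IsDiskFlowLine f z u) {t : ℝ} (ht : 0 ≤ t) :
    ‖u t‖ ≤ ‖z‖ := by
  choose! Φ hΦ hunique using hf.2
  have h0 : (0 : ℂ) ∈ ball (0 : ℂ) 1 := mem_ball_self one_pos
  have hzero : IsDiskFlowLine f 0 fun _ => 0 :=
    ⟨rfl, fun s _ => ⟨h0, by simpa [hf0] using hasDerivWithinAt_const s (Ici 0) (0 : ℂ)⟩⟩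
  rw [hunique z hz u hu ht]
  exact Complex.norm_le_norm_of_mapsTo_ball (f := fun w => Φ w t)
    (differentiableOn_of_isDiskFlowLine hf.1 hΦ ht)
    (fun w hw => ball_subset_closedBall ((hΦ w hw).2 t ht).1) (hunique 0 h0 _ hzero ht).symm
    (mem_ball_zero_iff.1 hz)

theorem inner_self_apply_nonneg (hf : IsDiskGenerator f) (hf0 : f 0 = 0) {z : ℂ}
    (hz : z ∈ ball (0 : ℂ) 1) : 0 ≤ inner ℝ z (f z) := by
  obtain ⟨u, hu, -⟩ := hf.2 z hz
  have := inner_nonpos_of_hasDerivWithinAt_of_norm_le (hu.2 0 le_rfl).2 fun t ht => by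
    simpa only [hu.1] using hf.norm_flowLine_le hf0 hz hu ht
  rwa [hu.1, inner_neg_right, neg_nonpos] at this

theorem differentiableOn_dslope (hf : IsDiskGenerator f) :
    DifferentiableOn ℂ (dslope f 0) (ball 0 1) :=
  (Complex.differentiableOn_dslope (ball_mem_nhds _ one_pos)).2 hf.1

theorem re_dslope_nonneg_of_ne_zero (hf : IsDiskGenerator f) (hf0 : f 0 = 0) {z : ℂ}
    (hz : z ∈ ball (0 : ℂ) 1) (hz0 : z ≠ 0) : 0 ≤ (dslope f 0 z).re := by
  have h := hf.inner_self_apply_nonneg hf0 hz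
  rw [← self_mul_dslope_zero hf0, Complex.inner, mul_right_comm, Complex.mul_conj,
    Complex.re_ofReal_mul] at h
  exact nonneg_of_mul_nonneg_right h (Complex.normSq_pos.2 hz0)

theorem re_dslope_nonneg (hf : IsDiskGenerator f) (hf0 : f 0 = 0) {z : ℂ}
    (hz : z ∈ ball (0 : ℂ) 1) : 0 ≤ (dslope f 0 z).re := by
  rcases eq_or_ne z 0 with rfl | hz0
  · have hcont : ContinuousAt (dslope f 0) 0 :=
      hf.differentiableOn_dslope.continuousOn.continuousAt (isOpen_ball.mem_nhds hz)
    refine ge_of_tendsto ((Complex.continuous_re.continuousAt.comp hcont).tendsto.mono_left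
      (nhdsWithin_le_nhds (s := {0}ᶜ))) ?_
    filter_upwards [self_mem_nhdsWithin, nhdsWithin_le_nhds (isOpen_ball.mem_nhds hz)]
      with w hw0 hw
    exact hf.re_dslope_nonneg_of_ne_zero hf0 hw hw0
  · exact hf.re_dslope_nonneg_of_ne_zero hf0 hz hz0

theorem norm_le_norm_add_mul (hf : IsDiskGenerator f) (hf0 : f 0 = 0) {r : ℝ} (hr : 0 ≤ r) {w : ℂ}
    (hw : w ∈ ball (0 : ℂ) 1) : ‖w‖ ≤ ‖w + r * f w‖ := by
  have hone : 1 ≤ ‖1 + r * dslope f 0 w‖ := by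
    refine le_trans ?_ (Complex.re_le_norm _)
    simpa using mul_nonneg hr (hf.re_dslope_nonneg hf0 hw)
  calc ‖w‖ ≤ ‖w‖ * ‖1 + r * dslope f 0 w‖ := le_mul_of_one_le_right (norm_nonneg w) hone
    _ = ‖w + r * f w‖ := by rw [← norm_mul, ← self_mul_dslope_zero hf0 w]; ring_nf

theorem mem_image_add_mul (hf : IsDiskGenerator f) (hf0 : f 0 = 0) {r : ℝ} (hr : 0 ≤ r) {z : ℂ}
    (hz : z ∈ ball (0 : ℂ) 1) : z ∈ (fun w : ℂ => w + r * f w) '' ball 0 1 :=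
  ball_subset_image_ball_of_dist_le (differentiableOn_id.add (hf.1.const_mul _))
    (fun w hw => by simpa [hf0] using hf.norm_le_norm_add_mul hf0 hr hw) (by simpa [hf0] using hz)

theorem nonlinearResolvent_mem_ball (hf : IsDiskGenerator f) (hf0 : f 0 = 0) {r : ℝ} (hr : 0 ≤ r)
    {z : ℂ} (hz : z ∈ ball (0 : ℂ) 1) : nonlinearResolvent f r z ∈ ball (0 : ℂ) 1 :=
  Function.invFunOn_mem (hf.mem_image_add_mul hf0 hr hz)

theorem nonlinearResolvent_add_mul (hf : IsDiskGenerator f) (hf0 : f 0 = 0) {r : ℝ} (hr : 0 ≤ r)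
    {z : ℂ} (hz : z ∈ ball (0 : ℂ) 1) :
    nonlinearResolvent f r z + r * f (nonlinearResolvent f r z) = z :=
  Function.invFunOn_eq (hf.mem_image_add_mul hf0 hr hz)

theorem norm_nonlinearResolvent_lt_inv (hf : IsDiskGenerator f) (hf0 : f 0 = 0) {r : ℝ}
    (hr : 1 < r * (deriv f 0).re) {z : ℂ} (hz : z ∈ ball (0 : ℂ) 1) :
    ‖nonlinearResolvent f r z‖ < (r * (deriv f 0).re - 1)⁻¹ := by
  have hre : ∀ w ∈ ball (0 : ℂ) 1, 0 ≤ (dslope f 0 w).re := fun w hw => hf.re_dslope_nonneg hf0 hw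
  rw [← dslope_same f 0] at hr ⊢
  have hr0 : 0 ≤ r := (pos_of_mul_pos_left (one_pos.trans hr) (hre 0 (mem_ball_self one_pos))).le
  refine norm_lt_inv_of_norm_mul_one_add_mul_lt_one hf.differentiableOn_dslope hre hr
    (hf.nonlinearResolvent_mem_ball hf0 hr0 hz) ?_
  rw [mul_add, mul_one, mul_left_comm, self_mul_dslope_zero hf0,
    hf.nonlinearResolvent_add_mul hf0 hr0 hz]
  exact mem_ball_zero_iff.1 hz

theorem norm_nonlinearResolvent_le (hf : IsDiskGenerator f) (hf0 : f 0 = 0) {r : ℝ}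
    (hr : 2 ≤ r * (deriv f 0).re) {z : ℂ} (hz : z ∈ ball (0 : ℂ) 1) :
    ‖nonlinearResolvent f r z‖ ≤ 3 / (1 + r * (deriv f 0).re) := by
  refine (hf.norm_nonlinearResolvent_lt_inv hf0 (by linarith) hz).le.trans ?_
  rw [inv_eq_one_div, div_le_div_iff₀ (by linarith) (by linarith)]
  linarith

theorem tendstoUniformlyOn_nonlinearResolvent (hf : IsDiskGenerator f) (hf0 : f 0 = 0)
    (hq : 0 < (deriv f 0).re) :
    TendstoUniformlyOn (fun r : ℝ => nonlinearResolvent f r) 0 atTop (ball 0 1) := by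
  have hscale : Tendsto (fun r : ℝ => r * (deriv f 0).re) atTop atTop :=
    tendsto_id.atTop_mul_const hq
  have hbound : Tendsto (fun r : ℝ => (r * (deriv f 0).re - 1)⁻¹) atTop (𝓝 0) :=
    (tendsto_atTop_add_const_right _ (-1) hscale).inv_tendsto_atTop
  rw [Metric.tendstoUniformlyOn_iff]
  intro ε hε
  filter_upwards [hbound.eventually_lt_const hε, hscale.eventually_gt_atTop 1] with r hrε hr z hz
  rw [Pi.zero_apply, dist_zero_left]
  exact (hf.norm_nonlinearResolvent_lt_inv hf0 hr hz).trans hrε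

end IsDiskGenerator

end Generator

section BoundaryFixedPoint

variable {ζ : ℂ}

theorem ofReal_mul_mem_stolzRegion (hζ : ‖ζ‖ = 1) {M : ℝ} (hM : 1 < M) {t : ℝ}
    (ht : t ∈ Ico (0 : ℝ) 1) : t * ζ ∈ stolzRegion ζ M := by
  have hnorm : ‖(t : ℂ) * ζ‖ = t := by simp [hζ, abs_of_nonneg ht.1]
  have hdist : ‖ζ - t * ζ‖ = 1 - t := by
    rw [← one_sub_mul, ← Complex.ofReal_one, ← Complex.ofReal_sub, norm_mul, hζ, mul_one,
      Complex.norm_of_nonneg (sub_nonneg.2 ht.2.le)]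
  refine ⟨hnorm.trans_lt ht.2, ?_⟩
  rw [hnorm, hdist]
  exact lt_mul_of_one_lt_left (sub_pos.2 ht.2) hM

theorem neBot_nhdsWithin_stolzRegion (hζ : ‖ζ‖ = 1) {M : ℝ} (hM : 1 < M) :
    (𝓝[stolzRegion ζ M] ζ).NeBot := by
  rw [← mem_closure_iff_nhdsWithin_neBot]
  have hradius : Tendsto (fun t : ℝ => (t : ℂ) * ζ) (𝓝 1) (𝓝 ζ) :=
    Continuous.tendsto' (by fun_prop) _ _ (by simp)
  refine mem_closure_of_tendsto (hradius.mono_left (nhdsWithin_le_nhds (s := Iio 1))) ?_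
  filter_upwards [Ico_mem_nhdsLT zero_lt_one] with t ht
  exact ofReal_mul_mem_stolzRegion hζ hM ht

theorem not_isBoundaryFixedPoint_of_norm_le {G : ℂ → ℂ} {c : ℝ} (hc : c < 1)
    (hG : ∀ z ∈ ball (0 : ℂ) 1, ‖G z‖ ≤ c) (ζ : ℂ) : ¬ IsBoundaryFixedPoint G ζ := by
  rintro ⟨hζ, hlim⟩
  have := neBot_nhdsWithin_stolzRegion hζ one_lt_two
  have hle : ‖ζ‖ ≤ c := le_of_tendsto (hlim 2 one_lt_two).norm <| by
    filter_upwards [self_mem_nhdsWithin] with z hz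
    exact hG z (mem_ball_zero_iff.2 hz.1)
  exact hle.not_gt (hζ ▸ hc)

end BoundaryFixedPoint

theorem mainTheorem5 (f : ℂ → ℂ) (hf : IsDiskGenerator f) (hf0 : f 0 = 0)
    (q : ℂ) (hfq : deriv f 0 = q) (hq : 0 < q.re) :
    (∀ r : ℝ, 2 / q.re < r →
      (∀ z ∈ Metric.ball (0 : ℂ) 1, ‖nonlinearResolvent f r z‖ ≤ 3 / (1 + r * q.re)) ∧
      (∀ ζ : ℂ, ¬ IsBoundaryFixedPoint (nonlinearResolvent f r) ζ)) ∧
    TendstoUniformlyOn (fun r : ℝ => nonlinearResolvent f r) (fun _ : ℂ => (0 : ℂ)) atTop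
      (Metric.ball (0 : ℂ) 1) := by
  subst hfq
  refine ⟨fun r hr => ?_, hf.tendstoUniformlyOn_nonlinearResolvent hf0 hq⟩
  have hrq : 2 < r * (deriv f 0).re := (div_lt_iff₀ hq).1 hr
  have hbound : ∀ z ∈ ball (0 : ℂ) 1,
      ‖nonlinearResolvent f r z‖ ≤ 3 / (1 + r * (deriv f 0).re) :=
    fun z hz => hf.norm_nonlinearResolvent_le hf0 hrq.le hz
  have hlt_one : 3 / (1 + r * (deriv f 0).re) < 1 := by
    rw [div_lt_one (by linarith)]
    linarith
  exact ⟨hbound, not_isBoundaryFixedPoint_of_norm_le hlt_one hbound⟩
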